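/- All rings are commutative. A Prüfer domain is an integral domain whose localization at each prime ideal is a valuation domain. An extension of rings $A\subseteq B$ is unibranched if contraction $\operatorname{Spec}(B)\to\operatorname{Spec}(A)$ is a bijection. A domain $D$ is a globalized pseudovaluation domain (GPVD) if there is a Prüfer domain $T\supseteq D$ such that (i) $D\subseteq T$ is unibranched, and (ii) there is a nonzero ideal $J$ common to $D$ and $T$ which is a radical ideal of both rings and such that every prime ideal of $T$ containing $J$ is maximal in $T$ and every prime ideal of $D$ containing $J$ is maximal in $D$. (The unit ideal is allowed as $J$, so every Prüfer domain is a GPVD.) The domain $T$ is contained in the fraction field of $D$, is uniquely determined by $D$, and is called the associated Prüfer domain of $D$; an ideal $J$ as in (ii) is called a common radical ideal of $D$ and $T$. A Prüfer domain $T$ is singular if there is a family $\Lambda$ of maximal ideals of $T$ such that $T=\bigcap_{\mathfrak m\in\Lambda}T_{\mathfrak m}$ (inside the fraction field of $T$), for each $\mathfrak m\in\Lambda$ the maximal ideal of $T_{\mathfrak m}$ is principal, generated by some $t_{\mathfrak m}$, and there are $t\in T$ and $n\in\mathbb N$ with $0<v_{\mathfrak m}(t)<n\,v_{\mathfrak m}(t_{\mathfrak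 m})$ for all $\mathfrak m\in\Lambda$, where $v_{\mathfrak m}$ is a valuation associated with $T_{\mathfrak m}$. A GPVD is pseudosingular if its associated Prüfer domain is singular. For a field $K$, a subring $R\subseteq K$, an ideal $I$ of $R$ and a subset $E\subseteq K$, let $\operatorname{Int}^{\mathrm R}(E,R)$ be the ring of all rational functions $\varphi\in K(x)$ which, for every $a\in E$, are defined at $a$ and satisfy $\varphi(a)\in R$, and let $\operatorname{Int}^{\mathrm R}(E,I)$ be its ideal of all $\varphi$ with $\varphi(a)\in I$ for every $a\in E$. **Theorem.** Let $D$ be a pseudosingular GPVD with field of fractions $K$ and associated Prüfer domain $T$, and let $E$ be a nonempty subset of $K$. Then $\operatorname{Int}^{\mathrm R}(E,D)$ is a GPVD, and its associated Prüfer domain is $\operatorname{Int}^{\mathrm R}(E,T)$. Moreover, for every common radical ideal $J$ of $D$ and $T$, the ideal $\operatorname{Int}^{\mathrm R}(E,J)$ is a common radical ideal of $\operatorname{Int}^{\mathrm R}(E,D)$ and $\operatorname{Int}^{\mathrm R}(E,T)$. -/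

import Mathlib

/-- The ring `Int^R(E,R)` of integer-valued rational functions on `E` over `R`: all `φ ∈ K(x)` that
are defined at every `a ∈ E` (the denominator of the reduced fraction does not vanish at `a`) with
`φ(a) ∈ R`. -/
noncomputable def intR {K : Type*} [Field K] (E : Set K) (R : Subring K) : Subring (RatFunc K) where
  carrier := {φ | ∀ a ∈ E, φ.denom.eval a ≠ 0 ∧ φ.eval (RingHom.id K) a ∈ R}
  zero_mem' := fun a _ => by simp [R.zero_mem]
  one_mem' := fun a _ => by simp [R.one_mem]
  add_mem' := by
    intro φ ψ hφ hψ a ha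
    obtain ⟨h1, h2⟩ := hφ a ha
    obtain ⟨h3, h4⟩ := hψ a ha
    refine ⟨fun h0 => ?_, ?_⟩
    · have h := Polynomial.eval_eq_zero_of_dvd_of_eval_eq_zero (RatFunc.denom_add_dvd φ ψ) h0
      rw [Polynomial.eval_mul] at h
      exact (mul_ne_zero h1 h3) h
    · rw [RatFunc.eval_add (RingHom.id K) a h1 h3]
      exact R.add_mem h2 h4
  mul_mem' := by
    intro φ ψ hφ hψ a ha
    obtain ⟨h1, h2⟩ := hφ a ha
    obtain ⟨h3, h4⟩ := hψ a ha
    refine ⟨fun h0 => ?_, ?_⟩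
    · have h := Polynomial.eval_eq_zero_of_dvd_of_eval_eq_zero (RatFunc.denom_mul_dvd φ ψ) h0
      rw [Polynomial.eval_mul] at h
      exact (mul_ne_zero h1 h3) h
    · rw [RatFunc.eval_mul (RingHom.id K) a h1 h3]
      exact R.mul_mem h2 h4
  neg_mem' := by
    intro φ hφ a ha
    obtain ⟨h1, h2⟩ := hφ a ha
    have hc : (RatFunc.C (-1 : K)).denom.eval₂ (RingHom.id K) a ≠ 0 := by
      rw [RatFunc.denom_C]; simp
    have e : -φ = RatFunc.C (-1 : K) * φ := by simp
    rw [e]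
    refine ⟨fun h0 => ?_, ?_⟩
    · have h := Polynomial.eval_eq_zero_of_dvd_of_eval_eq_zero
        (RatFunc.denom_mul_dvd (RatFunc.C (-1 : K)) φ) h0
      rw [Polynomial.eval_mul] at h
      exact (mul_ne_zero hc h1) h
    · rw [RatFunc.eval_mul (RingHom.id K) a hc h1, RatFunc.eval_C]
      simpa only [RingHom.id_apply, neg_one_mul] using R.neg_mem h2

/-- The ideal `Int^R(E,I)` of `Int^R(E,R)`: the functions all of whose values on `E` lie in `I`. -/
noncomputable def intRIdeal {K : Type*} [Field K] (E : Set K) {R : Subring K} (I : Ideal R) :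
    Ideal (intR E R) where
  carrier := {φ | ∀ (a : K) (ha : a ∈ E),
    (⟨(φ : RatFunc K).eval (RingHom.id K) a, (φ.2 a ha).2⟩ : R) ∈ I}
  zero_mem' := by
    intro a ha
    convert I.zero_mem using 1
    exact Subtype.ext (by simp)
  add_mem' := by
    intro φ ψ hφ hψ a ha
    convert I.add_mem (hφ a ha) (hψ a ha) using 1
    exact Subtype.ext (RatFunc.eval_add (RingHom.id K) a (φ.2 a ha).1 (ψ.2 a ha).1)
  smul_mem' := by
    intro φ ψ hψ a ha
    convert I.mul_mem_left ⟨(φ : RatFunc K).eval (RingHom.id K) a, (φ.2 a ha).2⟩ (hψ a ha) using 1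
    exact Subtype.ext (RatFunc.eval_mul (RingHom.id K) a (φ.2 a ha).1 (ψ.2 a ha).1)

/-- A domain is Prüfer if its localization at each prime ideal is a valuation domain. -/
def IsPruferDomain (R : Type*) [CommRing R] [IsDomain R] : Prop :=
  ∀ (P : Ideal R) [P.IsPrime], ValuationRing (Localization.AtPrime P)

/-- The extension `A ⊆ B` is unibranched: contraction `Spec B → Spec A` is a bijection. -/
def IsUnibranched {F : Type*} [Field F] {A B : Subring F} (h : A ≤ B) : Prop :=
  Function.Bijective (PrimeSpectrum.comap (Subring.inclusion h))

/-- `I` (as an ideal of `D`) and `I'` (as an ideal of `T`) are one and the same nonzero set, which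
is a radical ideal of both rings, and each prime of `D` or of `T` containing it is maximal there. -/
structure IsCommonRadicalIdeal {F : Type*} [Field F] (D T : Subring F)
    (I : Ideal D) (I' : Ideal T) : Prop where
  same_set : (Subtype.val '' (I : Set D) : Set F) = Subtype.val '' (I' : Set T)
  ne_bot : I ≠ ⊥
  isRadical_left : I.IsRadical
  isRadical_right : I'.IsRadical
  isMaximal_left : ∀ P : Ideal D, P.IsPrime → I ≤ P → P.IsMaximal
  isMaximal_right : ∀ P : Ideal T, P.IsPrime → I' ≤ P → P.IsMaximal

/-- `T` is a Prüfer domain associated with `D`: it witnesses that `D` is a GPVD. -/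
def IsAssociatedPruferDomain {F : Type*} [Field F] (D T : Subring F) : Prop :=
  ∃ h : D ≤ T, IsPruferDomain T ∧ IsUnibranched h ∧
    ∃ (I : Ideal D) (I' : Ideal T), IsCommonRadicalIdeal D T I I'

/-- `D` is a globalized pseudovaluation domain. A domain having a nonzero ideal in common with its
subring `D` embeds in the fraction field of `D`, so nothing is lost by looking for `T` among the
subrings of a given field containing `D`. -/
def IsGPVD {F : Type*} [Field F] (D : Subring F) : Prop :=
  ∃ T : Subring F, IsAssociatedPruferDomain D T

/-- The Prüfer domain `T`, with fraction field `K`, is singular. For `m ∈ Λ`, `V m` is the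
localization `T_m` as a valuation subring of `K`, and `(V m).valuation` is its valuation, written
multiplicatively: `v x < 1` is additively `0 < v x`, and `v s ^ n < v t` is `v t < n * v s`. -/
def IsSingularPrufer {K : Type*} [Field K] (T : Subring K) : Prop :=
  IsPruferDomain T ∧
  ∃ (Λ : Set (MaximalSpectrum T)) (V : MaximalSpectrum T → ValuationSubring K)
    (τ : ∀ m, V m) (t : T) (n : ℕ),
    (∀ m ∈ Λ, ∀ x : K, x ∈ V m ↔ ∃ a s : T, s ∉ m.asIdeal ∧ x = a / s) ∧
    (T = ⨅ m ∈ Λ, (V m).toSubring) ∧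
    (∀ m ∈ Λ, IsLocalRing.maximalIdeal (V m) = Ideal.span {τ m}) ∧
    ∀ m ∈ Λ, (V m).valuation t < 1 ∧ (V m).valuation (τ m) ^ n < (V m).valuation t

/-- `D`, with fraction field `K`, is a GPVD whose associated Prüfer domain is singular. -/
def IsPseudosingularGPVD {K : Type*} [Field K] (D : Subring K) : Prop :=
  ∃ T : Subring K, IsAssociatedPruferDomain D T ∧ IsSingularPrufer T

/-! Write valuations additively. For `m ∈ Λ`, the condition 0 < v(t) < n v(τ) keeps n v(y) and v(t)
+ n v(x) apart, so y^n + t x^n vanishes only at the origin and dominates y^n, y^(n-1) x and t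
x^(n-1) y. Substituting coprime polynomials gives functions in Int^R(E,T) that witness a
divisibility criterion for Prüfer domains (`IsDominatingParameter.isPruferDomain_intR`). If T = K,
Bézout identities serve instead.

The same form yields, for each φ, a quasi-inverse ψ: φ(1 - φψ) has values in J
(`IsDominatingParameter.exists_quasiInverse`), because t lies in the Jacobson radical of T and hence
in J. So Int^R(E,T) modulo Int^R(E,J) is von Neumann regular, and its primes are maximal.

Since D ⊆ T is unibranched, D contains all elements of T idempotent modulo J and the normalized
quasi-inverses modulo J of its own elements. Pointwise on E, this makes Int^R(E,D) modulo Int^R(E,J)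
regular too and puts φψ in Int^R(E,D). A prime over Int^R(E,J) contains φ exactly when it contains
φψ, so it is determined by its contraction (`bijective_comap_of_sharedIdeal`). Finally,
`IsAssociatedPruferDomain.unique` makes the given T singular and identifies the associated domain.
-/

section SharedIdeal

/-! ### Extensions sharing a radical ideal. -/

/-- `I` and `I'` correspond under `f`, are radical, and only maximal ideals are prime over them. -/
structure IsSharedRadicalIdeal {A B : Type*} [CommRing A] [CommRing B] (f : A →+* B)
    (I : Ideal A) (I' : Ideal B) : Prop where
  mem_iff : ∀ d, d ∈ I ↔ f d ∈ I'
  exists_eq : ∀ x ∈ I', ∃ d, f d = x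
  isRadical : I'.IsRadical
  isMaximal_left : ∀ P : Ideal A, P.IsPrime → I ≤ P → P.IsMaximal
  isMaximal_right : ∀ P : Ideal B, P.IsPrime → I' ≤ P → P.IsMaximal

variable {A B : Type*} [CommRing A] [CommRing B] {f : A →+* B} {I : Ideal A} {I' : Ideal B}

/-- Modulo `I'` the ring is reduced of dimension zero, so its localization at `N` is a field or
zero, and `m` dies there. -/
theorem exists_notMem_mul_mem_of_isRadical (hI : I'.IsRadical)
    (hmax : ∀ P : Ideal B, P.IsPrime → I' ≤ P → P.IsMaximal) (N : Ideal B) [N.IsPrime] {m : B}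
    (hm : m ∈ N) : ∃ c, c ∉ N ∧ c * m ∈ I' := by
  by_contra! h
  have hdisj : Disjoint (I' : Set B) (N.primeCompl ⊔ Submonoid.powers m : Submonoid B) := by
    rw [Set.disjoint_left]
    rintro x hx hxS
    obtain ⟨c, hc, y, ⟨k, rfl⟩, rfl⟩ := Submonoid.mem_sup.1 hxS
    refine h c hc (hI ⟨k + 1, ?_⟩)
    have : (c * m) ^ (k + 1) = (c ^ k * m) * (c * m ^ k) := by ring
    rw [this]
    exact I'.mul_mem_left _ hx
  obtain ⟨Q, hQ, hIQ, hQS⟩ := Ideal.exists_le_prime_disjoint I' _ hdisj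
  have hQN : Q ≤ N := fun x hx => by
    by_contra hxN
    exact Set.disjoint_left.1 hQS hx (Submonoid.mem_sup_left (show x ∈ N.primeCompl from hxN))
  have hEq : Q = N := (hmax Q hQ hIQ).eq_of_le (Ideal.IsPrime.ne_top') hQN
  exact Set.disjoint_left.1 hQS (hEq ▸ hm)
    (Submonoid.mem_sup_right (Submonoid.mem_powers m))

/-- Denominators outside `N` can be taken from `A`. When `I' ≤ N`, failure would give a second
prime, containing `s`, with the same contraction as `N`. -/
theorem exists_mul_eq_map_notMem (hmem : ∀ d, d ∈ I ↔ f d ∈ I') (hsurj : ∀ x ∈ I', ∃ d, f d = x)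
    (hmax : ∀ P : Ideal A, P.IsPrime → I ≤ P → P.IsMaximal)
    (hinj : Function.Injective (PrimeSpectrum.comap f)) (N : Ideal B) [hN : N.IsPrime] {s : B}
    (hs : s ∉ N) : ∃ (e : B) (d : A), e * s = f d ∧ f d ∉ N := by
  by_cases hIN : I' ≤ N
  · by_contra! h
    have hdisj : Disjoint ((Ideal.span {s} ⊔ I' : Ideal B) : Set B)
        ((N.comap f).primeCompl.map f : Submonoid B) := by
      rw [Set.disjoint_left]
      rintro x hx ⟨d, hd, rfl⟩
      obtain ⟨y, hy, j, hj, hyj⟩ := Submodule.mem_sup.1 hx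
      obtain ⟨a, rfl⟩ := Ideal.mem_span_singleton'.1 hy
      obtain ⟨i, rfl⟩ := hsurj j hj
      have h1 : f (d - i) ∈ N := h a (d - i) (by rw [map_sub, ← hyj]; ring)
      refine hd ?_
      have : f d = f (d - i) + f i := by rw [map_sub]; ring
      change f d ∈ N
      rw [this]
      exact N.add_mem h1 (hIN hj)
    obtain ⟨Q, hQ, hIQ, hQS⟩ := Ideal.exists_le_prime_disjoint _ _ hdisj
    have hQN : Q.comap f ≤ N.comap f := fun x hx => by
      by_contra hxN
      exact Set.disjoint_left.1 hQS hx ⟨x, hxN, rfl⟩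
    have hmaxQ : (Q.comap f).IsMaximal := hmax _ inferInstance
      fun x hx => hIQ (Ideal.mem_sup_right ((hmem x).1 hx))
    have hEq : Q.comap f = N.comap f := hmaxQ.eq_of_le Ideal.IsPrime.ne_top' hQN
    have hQN' : (⟨Q, hQ⟩ : PrimeSpectrum B) = ⟨N, hN⟩ := hinj (PrimeSpectrum.ext hEq)
    have hQN'' : Q = N := congrArg PrimeSpectrum.asIdeal hQN'
    exact hs (hQN'' ▸ hIQ (Ideal.mem_sup_left (Ideal.mem_span_singleton_self s)))
  · obtain ⟨j, hj, hjN⟩ := SetLike.not_le_iff_exists.1 hIN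
    obtain ⟨d, hd⟩ := hsurj _ (I'.mul_mem_right s hj)
    exact ⟨j, d, hd.symm, hd ▸ fun h => (hN.mem_or_mem h).elim hjN hs⟩

/-- The conductor of `c` into the image contains `I`, so only maximal ideals over `I` can obstruct
membership. -/
theorem mem_range_of_forall_isMaximal (hmem : ∀ d, d ∈ I ↔ f d ∈ I')
    (hsurj : ∀ x ∈ I', ∃ d, f d = x) {c : B}
    (h : ∀ M : Ideal A, M.IsMaximal → I ≤ M → ∃ s, s ∉ M ∧ f s * c ∈ f.range) : c ∈ f.range := by
  let C : Ideal A :=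
    { carrier := {x | f x * c ∈ f.range}
      zero_mem' := ⟨0, by simp⟩
      add_mem' := fun {x y} hx hy => by
        simpa only [Set.mem_ofPred_eq, map_add, add_mul] using add_mem hx hy
      smul_mem' := fun r x hx => by
        have := mul_mem (f.mem_range_self r) hx
        simpa only [Set.mem_ofPred_eq, smul_eq_mul, map_mul, mul_assoc] using this }
  have hIC : I ≤ C := fun x hx => by
    obtain ⟨d, hd⟩ := hsurj _ (I'.mul_mem_right c ((hmem x).1 hx))
    exact ⟨d, hd⟩
  by_cases hC : C = ⊤
  · have : (1 : A) ∈ C := hC ▸ Submodule.mem_top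
    have : f 1 * c ∈ f.range := this
    simpa using this
  · obtain ⟨M, hM, hCM⟩ := Ideal.exists_le_maximal C hC
    obtain ⟨s, hs, hsc⟩ := h M hM (hIC.trans hCM)
    exact absurd (hCM hsc) hs


namespace IsSharedRadicalIdeal

theorem exists_map_notMem_mul_mem (h : IsSharedRadicalIdeal f I I')
    (hinj : Function.Injective (PrimeSpectrum.comap f)) (N : Ideal B) [N.IsPrime] {s c : B}
    (hs : s ∉ N) (hc : c ∈ N) : ∃ e d, e * s = f d ∧ f d ∉ N ∧ e * c ∈ I' := by
  obtain ⟨c₀, hc₀, hcI⟩ := exists_notMem_mul_mem_of_isRadical h.isRadical h.isMaximal_right N hc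
  obtain ⟨e, d, hed, hd⟩ := exists_mul_eq_map_notMem h.mem_iff h.exists_eq h.isMaximal_left hinj N
    (s := c₀ * s) (fun hN => (Ideal.IsPrime.mem_or_mem ‹_› hN).elim hc₀ hs)
  refine ⟨e * c₀, d, by rw [← hed]; ring, hd, ?_⟩
  rw [mul_assoc]
  exact I'.mul_mem_left e hcI

theorem exists_prime_comap_eq (hbij : Function.Bijective (PrimeSpectrum.comap f))
    (M : Ideal A) [hM : M.IsPrime] : ∃ N : Ideal B, N.IsPrime ∧ N.comap f = M := by
  obtain ⟨N, hN⟩ := hbij.2 ⟨M, hM⟩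
  exact ⟨N.asIdeal, N.isPrime, congrArg PrimeSpectrum.asIdeal hN⟩

theorem le_of_le_comap (h : IsSharedRadicalIdeal f I I') {N : Ideal B} (hN : I ≤ N.comap f) :
    I' ≤ N := by
  intro x hx
  obtain ⟨d, rfl⟩ := h.exists_eq x hx
  exact hN ((h.mem_iff d).2 hx)

/-- At the prime `N` over each `M`, either `c` or `1 - c` lies in `N`, and a multiplier outside `M`
sends it into `I'`, which lies in the image. -/
theorem mem_range_of_mul_one_sub_mem (h : IsSharedRadicalIdeal f I I')
    (hbij : Function.Bijective (PrimeSpectrum.comap f)) {c : B} (hc : c * (1 - c) ∈ I') :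
    c ∈ f.range := by
  refine mem_range_of_forall_isMaximal h.mem_iff h.exists_eq fun M hM hIM => ?_
  obtain ⟨N, hN, rfl⟩ := exists_prime_comap_eq hbij M
  have hIN := h.le_of_le_comap hIM
  have h1 : (1 : B) ∉ N := fun h1 => hN.ne_top (N.eq_top_of_isUnit_mem h1 isUnit_one)
  rcases hN.mem_or_mem (hIN hc) with hcN | hcN
  · obtain ⟨e, d, hed, hd, hec⟩ := h.exists_map_notMem_mul_mem hbij.1 N h1 hcN
    refine ⟨d, hd, ?_⟩
    rw [← hed, mul_one]
    exact h.exists_eq _ hec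
  · obtain ⟨e, d, hed, hd, hec⟩ := h.exists_map_notMem_mul_mem hbij.1 N h1 hcN
    refine ⟨d, hd, ?_⟩
    have : f d * c = f d - e * (1 - c) := by rw [← hed]; ring
    rw [this]
    exact sub_mem (f.mem_range_self d) (h.exists_eq _ hec)

/-- Where `f a ∈ N`, the first relation forces `c ∈ N`, so `c` can be multiplied into `I'`;
elsewhere `a ^ 2` is itself a denominator, by the second relation. -/
theorem mem_range_of_quasiInverse (h : IsSharedRadicalIdeal f I I')
    (hbij : Function.Bijective (PrimeSpectrum.comap f)) {a : A} {c : B}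
    (hc : f a * c ^ 2 - c ∈ I') (ha : f a ^ 2 * c - f a ∈ I') : c ∈ f.range := by
  refine mem_range_of_forall_isMaximal h.mem_iff h.exists_eq fun M hM hIM => ?_
  obtain ⟨N, hN, rfl⟩ := exists_prime_comap_eq hbij M
  have hIN := h.le_of_le_comap hIM
  have h1 : (1 : B) ∉ N := fun h1 => hN.ne_top (N.eq_top_of_isUnit_mem h1 isUnit_one)
  by_cases haN : f a ∈ N
  · have hcN : c ∈ N := by
      have : c = f a * c ^ 2 - (f a * c ^ 2 - c) := by ring
      rw [this]
      exact N.sub_mem (N.mul_mem_right _ haN) (hIN hc)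
    obtain ⟨e, d, hed, hd, hec⟩ := h.exists_map_notMem_mul_mem hbij.1 N h1 hcN
    refine ⟨d, hd, ?_⟩
    rw [← hed, mul_one]
    exact h.exists_eq _ hec
  · refine ⟨a ^ 2, fun haM => haN (hN.mem_of_pow_mem 2 ?_), ?_⟩
    · simpa using haM
    · have : f (a ^ 2) * c = (f a ^ 2 * c - f a) + f a := by rw [map_pow]; ring
      rw [this]
      exact add_mem (h.exists_eq _ ha) (f.mem_range_self a)

end IsSharedRadicalIdeal

theorem isMaximal_of_quasiInverse {I : Ideal A} (h : ∀ a : A, ∃ c, a * (1 - a * c) ∈ I)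
    (P : Ideal A) (hP : P.IsPrime) (hIP : I ≤ P) : P.IsMaximal := by
  refine Ideal.isMaximal_iff.2 ⟨fun h1 => hP.ne_top (P.eq_top_of_isUnit_mem h1 isUnit_one), ?_⟩
  intro Q a hPQ haP haQ
  obtain ⟨c, hc⟩ := h a
  have h1 : 1 - a * c ∈ Q := hPQ ((hP.mem_or_mem (hIP hc)).resolve_left haP)
  have := Q.add_mem h1 (Q.mul_mem_right c haQ)
  simpa using this

/-- Over `I'`, a prime contains `b` exactly when it contains `b * c`, which comes from `A`. Away
from `I'`, multiplying by an element of the shared ideal outside the prime moves everything into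
`A`. -/
theorem bijective_comap_of_sharedIdeal (hf : Function.Injective f)
    (hmem : ∀ d, d ∈ I ↔ f d ∈ I') (hsurj : ∀ x ∈ I', ∃ d, f d = x)
    (hmax : ∀ P : Ideal A, P.IsPrime → I ≤ P → P.IsMaximal)
    (hsep : ∀ b : B, ∃ c, b * (1 - b * c) ∈ I' ∧ b * c ∈ f.range) :
    Function.Bijective (PrimeSpectrum.comap f) := by
  constructor
  · have key : ∀ Q₁ Q₂ : Ideal B, Q₁.IsPrime → Q₂.IsPrime → Q₁.comap f = Q₂.comap f → Q₁ ≤ Q₂ := by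
      intro Q₁ Q₂ h₁ h₂ heq x hx
      by_cases hI : I ≤ Q₁.comap f
      · obtain ⟨c, hc, a, ha⟩ := hsep x
        have h1 : a ∈ Q₁.comap f := by
          change f a ∈ Q₁
          rw [ha]
          exact Q₁.mul_mem_right c hx
        have h2 : x * c ∈ Q₂ := ha ▸ (heq ▸ h1 : a ∈ Q₂.comap f)
        obtain ⟨d, hd⟩ := hsurj _ hc
        have h3 : d ∈ Q₂.comap f := heq ▸ hI ((hmem d).2 (hd ▸ hc))
        have h4 : x * (1 - x * c) ∈ Q₂ := hd ▸ h3
        have : x = x * (1 - x * c) + x * (x * c) := by ring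
        rw [this]
        exact Q₂.add_mem h4 (Q₂.mul_mem_left x h2)
      · obtain ⟨j, hj, hjQ⟩ := SetLike.not_le_iff_exists.1 hI
        obtain ⟨d, hd⟩ := hsurj _ (I'.mul_mem_right x ((hmem j).1 hj))
        have h1 : d ∈ Q₁.comap f := by
          change f d ∈ Q₁
          rw [hd]
          exact Q₁.mul_mem_left _ hx
        have h2 : f j * x ∈ Q₂ := hd ▸ (heq ▸ h1 : d ∈ Q₂.comap f)
        exact (h₂.mem_or_mem h2).resolve_left fun hjQ₂ => hjQ (heq ▸ (hjQ₂ : j ∈ Q₂.comap f))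
    intro Q₁ Q₂ heq
    have heq' := congrArg PrimeSpectrum.asIdeal heq
    exact PrimeSpectrum.ext (le_antisymm (key _ _ Q₁.isPrime Q₂.isPrime heq')
      (key _ _ Q₂.isPrime Q₁.isPrime heq'.symm))
  · rintro ⟨P, hP⟩
    suffices h : ∃ Q : Ideal B, Q.IsPrime ∧ Q.comap f = P by
      obtain ⟨Q, hQ, rfl⟩ := h
      exact ⟨⟨Q, hQ⟩, rfl⟩
    by_cases hI : I ≤ P
    · have hdisj : Disjoint (I' : Set B) (P.primeCompl.map f : Submonoid B) := by
        rw [Set.disjoint_left]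
        rintro x hx ⟨d, hd, rfl⟩
        exact hd (hI ((hmem d).2 hx))
      obtain ⟨Q, hQ, hIQ, hQS⟩ := Ideal.exists_le_prime_disjoint _ _ hdisj
      have hQP : Q.comap f ≤ P := fun x hx => by
        by_contra hxP
        exact Set.disjoint_left.1 hQS hx ⟨x, hxP, rfl⟩
      refine ⟨Q, hQ, (hmax _ inferInstance fun x hx => hIQ ((hmem x).1 hx)).eq_of_le ?_ hQP⟩
      exact hP.ne_top
    · obtain ⟨j, hj, hjP⟩ := SetLike.not_le_iff_exists.1 hI
      -- The free factor `b` absorbs the scalars in the span induction; the case `b = 1` shows that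
      -- `P` is the contraction of its extension.
      have key : ∀ x ∈ P.map f, ∀ b, ∃ p ∈ P, f j * (b * x) = f p := by
        intro x hx
        induction hx using Submodule.span_induction with
        | mem x hx =>
          obtain ⟨p, hp, rfl⟩ := hx
          intro b
          obtain ⟨i, hi⟩ := hsurj _ (I'.mul_mem_right b ((hmem j).1 hj))
          exact ⟨i * p, P.mul_mem_left i hp, by rw [map_mul, hi, mul_assoc]⟩
        | zero => exact fun b => ⟨0, P.zero_mem, by simp⟩
        | add x y _ _ hx hy =>
          intro b
          obtain ⟨p, hp, hxp⟩ := hx b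
          obtain ⟨q, hq, hyq⟩ := hy b
          exact ⟨p + q, P.add_mem hp hq, by rw [mul_add, mul_add, hxp, hyq, map_add]⟩
        | smul r x _ hx =>
          intro b
          obtain ⟨p, hp, hxp⟩ := hx (b * r)
          exact ⟨p, hp, by rw [← hxp, smul_eq_mul, mul_assoc]⟩
      have hcomap : (P.map f).comap f = P := by
        refine le_antisymm (fun x hx => ?_) Ideal.le_comap_map
        obtain ⟨p, hp, hjp⟩ := key _ hx 1
        rw [one_mul, ← map_mul] at hjp
        exact (hP.mem_or_mem (hf hjp ▸ hp : j * x ∈ P)).resolve_left hjP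
      obtain ⟨Q, hQ, hQP⟩ := (Ideal.comap_map_eq_self_iff_of_isPrime P).1 hcomap
      exact ⟨Q, hQ, hQP⟩

end SharedIdeal
-- Divisibility criteria for Prüfer domains.
section Prufer

theorem IsPruferDomain.exists_notMem {R : Type*} [CommRing R] [IsDomain R] (h : IsPruferDomain R)
    (N : Ideal R) [N.IsPrime] (a b : R) :
    ∃ s, s ∉ N ∧ ∃ r, s * b = r * a ∨ s * a = r * b := by
  have := h N
  have key : ∀ a b : R, algebraMap R (Localization.AtPrime N) a ∣
      algebraMap R (Localization.AtPrime N) b → ∃ s, s ∉ N ∧ ∃ r, s * b = r * a := by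
    rintro a b ⟨q, hq⟩
    obtain ⟨⟨r, s⟩, hrs⟩ := IsLocalization.surj N.primeCompl q
    refine ⟨s, s.2, r, ?_⟩
    apply IsLocalization.injective (Localization.AtPrime N) N.primeCompl_le_nonZeroDivisors
    rw [map_mul, map_mul, hq, ← hrs]
    ring
  rcases ValuationRing.dvd_total (algebraMap R (Localization.AtPrime N) a)
    (algebraMap R (Localization.AtPrime N) b) with hab | hab
  · obtain ⟨s, hs, r, hr⟩ := key a b hab
    exact ⟨s, hs, r, Or.inl hr⟩
  · obtain ⟨s, hs, r, hr⟩ := key b a hab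
    exact ⟨s, hs, r, Or.inr hr⟩

/-- At any prime, `u` or `1 - u` becomes a unit, so one of `a`, `b` divides the other locally. -/
theorem isPruferDomain_of_exists {R : Type*} [CommRing R] [IsDomain R]
    (h : ∀ a b : R, ∃ u p q, u * a = p * b ∧ (1 - u) * b = q * a) : IsPruferDomain R := by
  intro P hP
  rw [ValuationRing.iff_dvd_total]
  refine ⟨fun x y => ?_⟩
  obtain ⟨a, s, rfl⟩ := IsLocalization.exists_mk'_eq P.primeCompl x
  obtain ⟨b, t, rfl⟩ := IsLocalization.exists_mk'_eq P.primeCompl y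
  have key : ∀ (a b : R) (s t : P.primeCompl) (u r : R), u ∉ P → u * a = r * b →
      IsLocalization.mk' (Localization.AtPrime P) b t ∣
        IsLocalization.mk' (Localization.AtPrime P) a s := by
    intro a b s t u r hu hur
    refine ⟨IsLocalization.mk' _ (r * t) (⟨u, hu⟩ * s : P.primeCompl), ?_⟩
    rw [← IsLocalization.mk'_mul, IsLocalization.mk'_eq_iff_eq]
    congr 1
    simp only [Submonoid.coe_mul]
    linear_combination (t * s : R) * hur
  obtain ⟨u, p, q, h1, h2⟩ := h a b
  by_cases hu : u ∈ P
  · left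
    refine key b a t s (1 - u) q (fun hu' => hP.ne_top (P.eq_top_of_isUnit_mem ?_ isUnit_one)) h2
    simpa using P.add_mem hu' hu
  · right
    exact key a b s t u p hu h1

end Prufer

/-! ### Uniqueness of the associated Prüfer domain. -/

section Associated

variable {F : Type*} [Field F] {D T T₁ T₂ : Subring F}

theorem IsCommonRadicalIdeal.isSharedRadicalIdeal {J : Ideal D} {J' : Ideal T}
    (hJ : IsCommonRadicalIdeal D T J J') (h : D ≤ T) :
    IsSharedRadicalIdeal (Subring.inclusion h) J J' where
  mem_iff d := by
    have key := Set.ext_iff.1 hJ.same_set (d : F)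
    constructor
    · intro hd
      obtain ⟨x, hx, hxd⟩ := key.1 ⟨d, hd, rfl⟩
      rwa [← show x = Subring.inclusion h d from Subtype.ext hxd]
    · intro hd
      obtain ⟨x, hx, hxd⟩ := key.2 ⟨_, hd, rfl⟩
      rwa [← show x = d from Subtype.ext hxd]
  exists_eq x hx := by
    obtain ⟨d, hd, hdx⟩ := (Set.ext_iff.1 hJ.same_set (x : F)).2 ⟨x, hx, rfl⟩
    exact ⟨d, Subtype.ext hdx⟩
  isRadical := hJ.isRadical_right
  isMaximal_left := hJ.isMaximal_left
  isMaximal_right := hJ.isMaximal_right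

theorem IsAssociatedPruferDomain.exists_eq_div (h : IsAssociatedPruferDomain D T) {y : F}
    (hy : y ∈ T) : ∃ a b : D, (b : F) ≠ 0 ∧ y * b = a := by
  obtain ⟨hDT, -, -, J, J', hJ⟩ := h
  have hs := hJ.isSharedRadicalIdeal hDT
  obtain ⟨j, hj, hj0⟩ := Submodule.exists_mem_ne_zero_of_ne_bot hJ.ne_bot
  obtain ⟨a, ha⟩ := hs.exists_eq _ (J'.mul_mem_left ⟨y, hy⟩ ((hs.mem_iff j).1 hj))
  exact ⟨a, j, fun h0 => hj0 (Subtype.ext h0), (congrArg Subtype.val ha).symm⟩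

/-- If `y ∉ T₂`, its conductor lies in a maximal `N`, where y⁻¹ is a local nonunit. Clearing
denominators into `D` gives d = d' y with d' ∈ N and d ∉ N; but a prime of `T₁` over N ∩ D contains
d', hence d. -/
theorem IsAssociatedPruferDomain.le (h₁ : IsAssociatedPruferDomain D T₁)
    (h₂ : IsAssociatedPruferDomain D T₂) : T₁ ≤ T₂ := by
  intro y hy
  obtain ⟨a, b, hb, hab⟩ := h₁.exists_eq_div hy
  obtain ⟨hDT₁, -, hub₁, -⟩ := h₁
  obtain ⟨hDT₂, hpr, hub₂, J, J', hJ⟩ := h₂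
  have hs := hJ.isSharedRadicalIdeal hDT₂
  let C : Ideal T₂ :=
    { carrier := {x | (x : F) * y ∈ T₂}
      zero_mem' := by simp
      add_mem' := fun {x z} hx hz => by
        simpa only [Set.mem_ofPred_eq, Subring.coe_add, add_mul] using T₂.add_mem hx hz
      smul_mem' := fun r x hx => by
        simpa only [Set.mem_ofPred_eq, smul_eq_mul, Subring.coe_mul, mul_assoc] using
          T₂.mul_mem r.2 hx }
  by_cases hC : C = ⊤
  · have h1 : (1 : T₂) ∈ C := hC ▸ Submodule.mem_top
    have h1 : ((1 : T₂) : F) * y ∈ T₂ := h1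
    simpa using h1
  exfalso
  obtain ⟨N, hN, hCN⟩ := Ideal.exists_le_maximal C hC
  obtain ⟨s, hsN, r, hr⟩ := hpr.exists_notMem N (Subring.inclusion hDT₂ a)
    (Subring.inclusion hDT₂ b)
  rcases hr with hr | hr
  · have hr' : (s : F) * b = r * a := congrArg Subtype.val hr
    have hry : (s : F) = r * y := by
      apply mul_right_cancel₀ hb
      rw [hr', mul_assoc, hab]
    have hrN : r ∈ N := hCN (show (r : F) * y ∈ T₂ from hry ▸ s.2)
    obtain ⟨e, d, hed, hd, her⟩ := hs.exists_map_notMem_mul_mem hub₂.1 N hsN hrN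
    obtain ⟨d', hd'⟩ := hs.exists_eq _ her
    have hdy : (d : F) = d' * y := by
      have h1 : (e : F) * s = d := congrArg Subtype.val hed
      have h2 : (d' : F) = e * r := congrArg Subtype.val hd'
      rw [← h1, h2, hry, mul_assoc]
    obtain ⟨N₁, hN₁, hN₁'⟩ := IsSharedRadicalIdeal.exists_prime_comap_eq hub₁
      (N.comap (Subring.inclusion hDT₂))
    have hd'N : d' ∈ N.comap (Subring.inclusion hDT₂) := by
      change Subring.inclusion hDT₂ d' ∈ N
      rw [hd']
      exact N.mul_mem_left e hrN
    rw [← hN₁'] at hd'N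
    have hdN : d ∈ N₁.comap (Subring.inclusion hDT₁) := by
      change Subring.inclusion hDT₁ d ∈ N₁
      have : Subring.inclusion hDT₁ d = Subring.inclusion hDT₁ d' * ⟨y, hy⟩ := Subtype.ext hdy
      rw [this]
      exact N₁.mul_mem_right _ hd'N
    rw [hN₁'] at hdN
    exact hd hdN
  · have hr' : (s : F) * a = r * b := congrArg Subtype.val hr
    have hsy : (s : F) * y = r := by
      apply mul_right_cancel₀ hb
      rw [← hr', mul_assoc, hab]
    exact hsN (hCN (show (s : F) * y ∈ T₂ from hsy ▸ r.2))

theorem IsAssociatedPruferDomain.unique (h₁ : IsAssociatedPruferDomain D T₁)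
    (h₂ : IsAssociatedPruferDomain D T₂) : T₁ = T₂ :=
  le_antisymm (h₁.le h₂) (h₂.le h₁)

end Associated

/-! ### The dominating form of a singular Prüfer domain. -/

section Singular

variable {K : Type*} [Field K]

theorem ValuationSubring.two_le_of_valuation_pow_lt {V : ValuationSubring K} {τ : V} {t : K} {n : ℕ}
    (hmax : ∀ x : K, V.valuation x < 1 → V.valuation x ≤ V.valuation τ)
    (ht : V.valuation t < 1) (hn : V.valuation τ ^ n < V.valuation t) : 2 ≤ n := by
  by_contra! h
  interval_cases n
  · exact lt_asymm (by simpa using hn) ht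
  · exact absurd (hmax t ht) (not_le.2 (by simpa using hn))

theorem ValuationSubring.valuation_le_of_maximalIdeal_eq {V : ValuationSubring K} {τ : V}
    (h : IsLocalRing.maximalIdeal V = Ideal.span {τ}) (x : K) (hx : V.valuation x < 1) :
    V.valuation x ≤ V.valuation τ := by
  have hxV : x ∈ V := (V.valuation_le_one_iff x).1 hx.le
  have hxm : (⟨x, hxV⟩ : V) ∈ IsLocalRing.maximalIdeal V := (V.valuation_lt_one_iff ⟨x, hxV⟩).2 hx
  rw [h] at hxm
  obtain ⟨c, hc⟩ := Ideal.mem_span_singleton'.1 hxm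
  have : x = (c : K) * τ := (congrArg Subtype.val hc).symm
  rw [this, map_mul]
  exact mul_le_of_le_one_left' (V.valuation_le_one c)

/-- For `v(τ)` the least positive value and `0 < v(t) < n v(τ)`, the values of `y ^ n` and `t x ^ n`
never agree, so `y ^ n + t x ^ n` has the smaller of the two. -/
theorem ValuationSubring.forms_mem {V : ValuationSubring K} {τ : V} {t : K} {n : ℕ}
    (hmax : ∀ x : K, V.valuation x < 1 → V.valuation x ≤ V.valuation τ)
    (ht : V.valuation t < 1) (hn : V.valuation τ ^ n < V.valuation t) {x y : K}
    (hxy : x ≠ 0 ∨ y ≠ 0) :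
    y ^ n + t * x ^ n ≠ 0 ∧ y ^ n / (y ^ n + t * x ^ n) ∈ V ∧
      y ^ (n - 1) * x / (y ^ n + t * x ^ n) ∈ V ∧
      t * x ^ (n - 1) * y / (y ^ n + t * x ^ n) ∈ V := by
  -- From here `n` is the original exponent less one.
  obtain ⟨n, rfl⟩ : ∃ k, n = k + 1 :=
    ⟨n - 1, by have := two_le_of_valuation_pow_lt hmax ht hn; omega⟩
  rw [Nat.add_sub_cancel]
  set v := V.valuation
  have div_mem : ∀ p q : K, q ≠ 0 → v p ≤ v q → p / q ∈ V := fun p q hq hpq => by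
    rw [← V.valuation_le_one_iff, map_div₀]
    exact (div_le_one₀ (zero_lt_iff.2 ((map_ne_zero v).2 hq))).2 hpq
  have ht0 : 0 < v t := lt_of_le_of_lt zero_le hn
  rcases le_or_gt (v x) (v y) with hle | hlt
  · have hy : 0 < v y := by
      rcases hxy with h | h
      · exact lt_of_lt_of_le (zero_lt_iff.2 ((map_ne_zero v).2 h)) hle
      · exact zero_lt_iff.2 ((map_ne_zero v).2 h)
    have hlt : v (t * x ^ (n + 1)) < v (y ^ (n + 1)) := by
      rw [map_mul, map_pow, map_pow]
      calc v t * v x ^ (n + 1) ≤ v t * v y ^ (n + 1) := by gcongr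
        _ < 1 * v y ^ (n + 1) := mul_lt_mul_of_pos_right ht (pow_pos hy _)
        _ = v y ^ (n + 1) := one_mul _
    have hsum := Valuation.map_add_eq_of_lt_left v hlt
    have hne : y ^ (n + 1) + t * x ^ (n + 1) ≠ 0 := by
      rw [← map_ne_zero v, hsum, map_pow]
      exact (pow_pos hy _).ne'
    refine ⟨hne, div_mem _ _ hne hsum.ge, div_mem _ _ hne ?_, div_mem _ _ hne ?_⟩
    · rw [hsum, map_mul, map_pow, map_pow, pow_succ]
      gcongr
    · rw [hsum, map_mul, map_mul, map_pow, map_pow, pow_succ]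
      gcongr
      calc v t * v x ^ n ≤ 1 * v y ^ n := by gcongr
        _ = v y ^ n := one_mul _
  · have hx : 0 < v x := lt_of_le_of_lt zero_le hlt
    have hyx : v y ≤ v τ * v x := by
      have h1 : v (y / x) < 1 := by
        rw [map_div₀]
        exact (div_lt_one₀ hx).2 hlt
      have h2 := hmax _ h1
      rw [map_div₀] at h2
      exact (div_le_iff₀ hx).1 h2
    -- τ^(n+1)/t has value below 1, hence at most that of τ; cancel one τ. This sharpened bound
    -- controls y^n x, where one factor y is missing.
    have hτ : v τ ^ n ≤ v t := by
      have hτ0 : 0 < v τ := lt_of_lt_of_le ht0 (hmax t ht)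
      have h1 : v ((τ : K) ^ (n + 1) / t) < 1 := by
        rw [map_div₀, map_pow]
        exact (div_lt_one₀ ht0).2 hn
      have h2 := hmax _ h1
      rw [map_div₀, map_pow, div_le_iff₀ ht0, pow_succ'] at h2
      exact le_of_mul_le_mul_left h2 hτ0
    have hlt' : v (y ^ (n + 1)) < v (t * x ^ (n + 1)) := by
      rw [map_mul, map_pow, map_pow]
      calc v y ^ (n + 1) ≤ (v τ * v x) ^ (n + 1) := by gcongr
        _ = v τ ^ (n + 1) * v x ^ (n + 1) := mul_pow _ _ _
        _ < v t * v x ^ (n + 1) := mul_lt_mul_of_pos_right hn (pow_pos hx _)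
    have hsum := Valuation.map_add_eq_of_lt_right v hlt'
    have hne : y ^ (n + 1) + t * x ^ (n + 1) ≠ 0 := by
      rw [← map_ne_zero v, hsum, map_mul, map_pow]
      exact (mul_pos ht0 (pow_pos hx _)).ne'
    refine ⟨hne, div_mem _ _ hne ?_, div_mem _ _ hne ?_, div_mem _ _ hne ?_⟩
    · exact hsum ▸ hlt'.le
    · rw [hsum, map_mul, map_mul, map_pow, map_pow, pow_succ, ← mul_assoc]
      gcongr
      calc v y ^ n ≤ (v τ * v x) ^ n := by gcongr
        _ = v τ ^ n * v x ^ n := mul_pow _ _ _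
        _ ≤ v t * v x ^ n := by gcongr
    · rw [hsum, map_mul, map_mul, map_mul, map_pow, map_pow, pow_succ, ← mul_assoc]
      gcongr

/-- `y ^ n + t x ^ n` vanishes only at the origin and dominates the forms listed, over `T`. -/
structure IsDominatingParameter (T : Subring K) (t : T) (n : ℕ) : Prop where
  two_le : 2 ≤ n
  isUnit_one_add : ∀ z : T, IsUnit (1 + t * z)
  ne_zero : ∀ x y : K, x ≠ 0 ∨ y ≠ 0 → y ^ n + t * x ^ n ≠ 0
  mem₁ : ∀ x y : K, x ≠ 0 ∨ y ≠ 0 → y ^ n / (y ^ n + t * x ^ n) ∈ T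
  mem₂ : ∀ x y : K, x ≠ 0 ∨ y ≠ 0 → y ^ (n - 1) * x / (y ^ n + t * x ^ n) ∈ T
  mem₃ : ∀ x y : K, x ≠ 0 ∨ y ≠ 0 → t * x ^ (n - 1) * y / (y ^ n + t * x ^ n) ∈ T

theorem IsSingularPrufer.exists_isDominatingParameter {T : Subring K} (h : IsSingularPrufer T)
    (hT : T ≠ ⊤) : ∃ t n, IsDominatingParameter T t n := by
  obtain ⟨-, Λ, V, τ, t, n, -, hTV, hτ, ht⟩ := h
  have mem_iff : ∀ x : K, x ∈ T ↔ ∀ m ∈ Λ, x ∈ V m := fun x => by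
    have hx : x ∈ T ↔ x ∈ ⨅ m ∈ Λ, (V m).toSubring := by rw [← hTV]
    simpa [Subring.mem_iInf] using hx
  have hforms := fun m hm x y hxy => ValuationSubring.forms_mem (x := x) (y := y)
    (ValuationSubring.valuation_le_of_maximalIdeal_eq (hτ m hm)) (ht m hm).1 (ht m hm).2 hxy
  -- An empty intersection would be all of `K`; one valuation is needed to see that the form does
  -- not vanish.
  have hne : ∃ m, m ∈ Λ := by
    by_contra! hΛ
    exact hT (eq_top_iff.2 fun x _ => (mem_iff x).2 fun m hm => absurd hm (hΛ m))
  obtain ⟨m₀, hm₀⟩ := hne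
  refine ⟨t, n, ?_, ?_, fun x y hxy => (hforms m₀ hm₀ x y hxy).1,
    fun x y hxy => (mem_iff _).2 fun m hm => (hforms m hm x y hxy).2.1,
    fun x y hxy => (mem_iff _).2 fun m hm => (hforms m hm x y hxy).2.2.1,
    fun x y hxy => (mem_iff _).2 fun m hm => (hforms m hm x y hxy).2.2.2⟩
  · exact ValuationSubring.two_le_of_valuation_pow_lt
      (ValuationSubring.valuation_le_of_maximalIdeal_eq (hτ m₀ hm₀)) (ht m₀ hm₀).1 (ht m₀ hm₀).2
  · intro z
    have hval : ∀ m ∈ Λ, (V m).valuation (1 + t * z) = 1 := fun m hm => by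
      refine Valuation.map_one_add_of_lt _ ?_
      rw [map_mul]
      exact mul_lt_one_of_lt_of_le (ht m hm).1
        (((V m).valuation_le_one_iff _).2 ((mem_iff _).1 z.2 m hm))
    have h0 : (1 + t * z : K) ≠ 0 := fun h0 => by
      have := hval m₀ hm₀
      rw [h0, map_zero] at this
      exact zero_ne_one this
    have hinv : (1 + t * z : K)⁻¹ ∈ T := (mem_iff _).2 fun m hm => by
      rw [← (V m).valuation_le_one_iff, map_inv₀, hval m hm, inv_one]
    exact IsUnit.of_mul_eq_one ⟨_, hinv⟩ (Subtype.ext (mul_inv_cancel₀ h0))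

/-- `t` is in the Jacobson radical, and `J'` is an intersection of maximal ideals. -/
theorem IsDominatingParameter.mem_of_isCommonRadicalIdeal {D T : Subring K} {t : T} {n : ℕ}
    (h : IsDominatingParameter T t n) {J : Ideal D} {J' : Ideal T}
    (hJ : IsCommonRadicalIdeal D T J J') : t ∈ J' := by
  rw [← hJ.isRadical_right.radical, Ideal.radical_eq_sInf, Submodule.mem_sInf]
  rintro (P : Ideal T) ⟨hJP, hP⟩
  have hPm := hJ.isMaximal_right P hP hJP
  by_contra htP
  obtain ⟨z, p, hp, hz⟩ := Ideal.IsMaximal.exists_inv hPm htP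
  refine hP.ne_top (P.eq_top_of_isUnit_mem ?_ (h.isUnit_one_add (-z)))
  have : 1 + t * -z = p := by linear_combination -hz
  rwa [this]

end Singular
-- Rings of integer-valued rational functions.
section IntegerValued

open Polynomial

variable {K : Type*} [Field K] {E : Set K} {R D T : Subring K}

theorem RatFunc.eval_algebraMap_div {a : K} (p q : K[X]) (hq : q.eval a ≠ 0) :
    (algebraMap K[X] (RatFunc K) p / algebraMap K[X] (RatFunc K) q).denom.eval a ≠ 0 ∧
      (algebraMap K[X] (RatFunc K) p / algebraMap K[X] (RatFunc K) q).eval (RingHom.id K) a =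
        p.eval a / q.eval a := by
  have hq0 : q ≠ 0 := fun h => hq (by rw [h, Polynomial.eval_zero])
  set φ := algebraMap K[X] (RatFunc K) p / algebraMap K[X] (RatFunc K) q with hφ
  have hd : φ.denom.eval a ≠ 0 := fun h =>
    hq (Polynomial.eval_eq_zero_of_dvd_of_eval_eq_zero (RatFunc.denom_div_dvd p q) h)
  refine ⟨hd, ?_⟩
  have h1 := congrArg (Polynomial.eval a) ((RatFunc.num_mul_eq_mul_denom_iff hq0).2 hφ)
  rw [Polynomial.eval_mul, Polynomial.eval_mul] at h1
  rw [RatFunc.eval, Polynomial.eval₂_id, Polynomial.eval₂_id]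
  exact (div_eq_div_iff hd hq).2 h1

theorem algebraMap_div_mem_intR (p q : K[X])
    (h : ∀ a ∈ E, q.eval a ≠ 0 ∧ p.eval a / q.eval a ∈ R) :
    algebraMap K[X] (RatFunc K) p / algebraMap K[X] (RatFunc K) q ∈ intR E R := fun a ha => by
  obtain ⟨h1, h2⟩ := RatFunc.eval_algebraMap_div p q (h a ha).1
  exact ⟨h1, h2 ▸ (h a ha).2⟩

theorem C_mem_intR {c : K} (hc : c ∈ R) : RatFunc.C c ∈ intR E R := fun a _ =>
  ⟨by simp, by rwa [RatFunc.eval_C]⟩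

theorem intR_mono (h : D ≤ T) : intR E D ≤ intR E T := fun _ hφ a ha =>
  ⟨(hφ a ha).1, h (hφ a ha).2⟩

/-- Evaluation at a point of `E`. -/
noncomputable def intREval (R : Subring K) {a : K} (ha : a ∈ E) : intR E R →+* R where
  toFun φ := ⟨(φ : RatFunc K).eval (RingHom.id K) a, (φ.2 a ha).2⟩
  map_one' := Subtype.ext (by simp)
  map_zero' := Subtype.ext (by simp)
  map_add' φ ψ := Subtype.ext (RatFunc.eval_add (RingHom.id K) a (φ.2 a ha).1 (ψ.2 a ha).1)
  map_mul' φ ψ := Subtype.ext (RatFunc.eval_mul (RingHom.id K) a (φ.2 a ha).1 (ψ.2 a ha).1)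

theorem mem_intRIdeal_iff {I : Ideal R} {φ : intR E R} :
    φ ∈ intRIdeal E I ↔ ∀ (a : K) (ha : a ∈ E), intREval R ha φ ∈ I := Iff.rfl

theorem intREval_C {c : K} (hc : c ∈ R) {a : K} (ha : a ∈ E) :
    intREval R ha ⟨RatFunc.C c, C_mem_intR hc⟩ = ⟨c, hc⟩ :=
  Subtype.ext (RatFunc.eval_C (RingHom.id K) a)

theorem mem_range_inclusion_intR (h : D ≤ T) {φ : intR E T}
    (hφ : ∀ (a : K) (ha : a ∈ E), intREval T ha φ ∈ (Subring.inclusion h).range) :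
    φ ∈ (Subring.inclusion (intR_mono (E := E) h)).range := by
  refine ⟨⟨φ, fun a ha => ⟨(φ.2 a ha).1, ?_⟩⟩, rfl⟩
  obtain ⟨d, hd⟩ := hφ a ha
  have hd' : (d : K) = (φ : RatFunc K).eval (RingHom.id K) a := congrArg Subtype.val hd
  exact hd' ▸ d.2

theorem isRadical_intRIdeal {I : Ideal R} (hI : I.IsRadical) : (intRIdeal E I).IsRadical := by
  rintro φ ⟨n, hn⟩ a ha
  refine hI ⟨n, ?_⟩
  have := mem_intRIdeal_iff.1 hn a ha
  rwa [map_pow] at this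

/-- The divisibility relations depend only on the quotient of the two elements, which may be put in
lowest terms; coprime polynomials have no common zero. -/
theorem isPruferDomain_intR_of_isCoprime
    (h : ∀ f g : K[X], IsCoprime f g → g ≠ 0 → ∃ u ∈ intR E R, ∃ p ∈ intR E R, ∃ q ∈ intR E R,
      u * algebraMap K[X] (RatFunc K) f = p * algebraMap K[X] (RatFunc K) g ∧
      (1 - u) * algebraMap K[X] (RatFunc K) g = q * algebraMap K[X] (RatFunc K) f) :
    IsPruferDomain (intR E R) := by
  refine isPruferDomain_of_exists fun φ ψ => ?_
  by_cases hψ : ψ = 0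
  · exact ⟨0, 0, 0, by simp, by simp [hψ]⟩
  set χ : RatFunc K := φ / ψ with hχ
  have hψ' : (ψ : RatFunc K) ≠ 0 := fun h0 => hψ (Subtype.ext h0)
  obtain ⟨u, hu, p, hp, q, hq, h1, h2⟩ := h χ.num χ.denom (RatFunc.isCoprime_num_denom χ)
    (RatFunc.denom_ne_zero χ)
  have hg : algebraMap K[X] (RatFunc K) χ.denom ≠ 0 :=
    RatFunc.algebraMap_ne_zero (RatFunc.denom_ne_zero χ)
  set F := algebraMap K[X] (RatFunc K) χ.num
  set G := algebraMap K[X] (RatFunc K) χ.denom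
  have hFG : F * ψ = G * φ := by
    have h3 : F / G = φ / ψ := RatFunc.num_div_denom χ
    rw [div_eq_div_iff hg hψ'] at h3
    rw [h3, mul_comm]
  refine ⟨⟨u, hu⟩, ⟨p, hp⟩, ⟨q, hq⟩, Subtype.ext ?_, Subtype.ext ?_⟩
  · apply mul_left_cancel₀ hg
    change G * (u * φ) = G * (p * ψ)
    linear_combination (ψ : RatFunc K) * h1 - u * hFG
  · apply mul_left_cancel₀ hg
    change G * ((1 - u) * ψ) = G * (q * φ)
    linear_combination (ψ : RatFunc K) * h2 + q * hFG

theorem isPruferDomain_intR_top : IsPruferDomain (intR E (⊤ : Subring K)) := by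
  refine isPruferDomain_intR_of_isCoprime fun f g hfg _ => ?_
  obtain ⟨a, b, hab⟩ := hfg
  have hpoly : ∀ p : K[X], algebraMap K[X] (RatFunc K) p ∈ intR E (⊤ : Subring K) := fun p => by
    simpa using algebraMap_div_mem_intR (E := E) (R := ⊤) p 1 (by simp)
  refine ⟨_, hpoly (b * g), _, hpoly (b * f), _, hpoly (a * g), ?_, ?_⟩
  · rw [← map_mul, ← map_mul]
    congr 1
    ring
  · rw [← map_one (algebraMap K[X] (RatFunc K)), ← map_sub, ← map_mul, ← map_mul]
    congr 1
    linear_combination -g * hab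

theorem IsCoprime.eval_ne_zero_or {f g : K[X]} (h : IsCoprime f g) (a : K) :
    f.eval a ≠ 0 ∨ g.eval a ≠ 0 := by
  obtain ⟨u, v, huv⟩ := h
  by_contra! h0
  have := congrArg (Polynomial.eval a) huv
  simp [h0.1, h0.2] at this

namespace IsDominatingParameter

variable {t : T} {n : ℕ}

theorem forms_mem_intR (h : IsDominatingParameter T t n) (hE : E.Nonempty) {f g : K[X]}
    (hfg : IsCoprime f g) :
    let ι := algebraMap K[X] (RatFunc K)
    let Q := g ^ n + Polynomial.C (t : K) * f ^ n
    ι Q ≠ 0 ∧ ι (g ^ n) / ι Q ∈ intR E T ∧ ι (g ^ (n - 1) * f) / ι Q ∈ intR E T ∧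
      ι (Polynomial.C (t : K) * f ^ (n - 1) * g) / ι Q ∈ intR E T := by
  intro ι Q
  have hQ : ∀ a, Q.eval a = g.eval a ^ n + t * f.eval a ^ n := fun a => by simp [Q]
  have hQ0 : ∀ a, Q.eval a ≠ 0 := fun a => hQ a ▸ h.ne_zero _ _ (hfg.eval_ne_zero_or a)
  obtain ⟨a₀, -⟩ := hE
  refine ⟨RatFunc.algebraMap_ne_zero fun h0 => hQ0 a₀ (by rw [h0, Polynomial.eval_zero]),
    algebraMap_div_mem_intR _ _ fun a _ => ⟨hQ0 a, ?_⟩,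
    algebraMap_div_mem_intR _ _ fun a _ => ⟨hQ0 a, ?_⟩,
    algebraMap_div_mem_intR _ _ fun a _ => ⟨hQ0 a, ?_⟩⟩
  · simpa [hQ] using h.mem₁ _ _ (hfg.eval_ne_zero_or a)
  · simpa [hQ] using h.mem₂ _ _ (hfg.eval_ne_zero_or a)
  · simpa [hQ] using h.mem₃ _ _ (hfg.eval_ne_zero_or a)

theorem isPruferDomain_intR (h : IsDominatingParameter T t n) (hE : E.Nonempty) :
    IsPruferDomain (intR E T) := by
  refine isPruferDomain_intR_of_isCoprime fun f g hfg _ => ?_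
  obtain ⟨hQ, h1, h2, h3⟩ := h.forms_mem_intR hE hfg
  obtain ⟨m, rfl⟩ : ∃ m, n = m + 1 := ⟨n - 1, by have := h.two_le; omega⟩
  refine ⟨_, h1, _, h2, _, h3, ?_, ?_⟩
  · simp only [map_mul, map_pow, Nat.add_sub_cancel]
    ring
  · rw [one_sub_div hQ]
    simp only [map_mul, map_pow, map_add, Nat.add_sub_cancel]
    ring

theorem exists_quasiInverse (h : IsDominatingParameter T t n) (hE : E.Nonempty) {J : Ideal T}
    (hJ : J.IsRadical) (htJ : t ∈ J) (φ : intR E T) :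
    ∃ ψ, φ * (1 - φ * ψ) ∈ intRIdeal E J := by
  -- For φ = F/G the roles are swapped: ψ = F^(n-1) G / (F^n + t G^n), so that φψ = F^n / (F^n + t
  -- G^n).
  obtain ⟨hQ, -, h2, -⟩ := h.forms_mem_intR hE (RatFunc.isCoprime_num_denom (φ : RatFunc K)).symm
  obtain ⟨m, rfl⟩ : ∃ m, n = m + 1 := ⟨n - 1, by have := h.two_le; omega⟩
  refine ⟨⟨_, h2⟩, ?_⟩
  set ψ : intR E T := ⟨_, h2⟩ with hψ
  have key : φ ^ (m + 1) * (1 - φ * ψ) = ⟨RatFunc.C (t : K), C_mem_intR t.2⟩ * (φ * ψ) := by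
    apply Subtype.ext
    have hg : algebraMap K[X] (RatFunc K) (φ : RatFunc K).denom ≠ 0 :=
      RatFunc.algebraMap_ne_zero (RatFunc.denom_ne_zero _)
    change (φ : RatFunc K) ^ (m + 1) * (1 - φ * ψ) = RatFunc.C (t : K) * (φ * ψ)
    rw [hψ]
    simp only [Nat.add_sub_cancel]
    have hFG := RatFunc.num_div_denom (φ : RatFunc K)
    simp only [map_mul, map_pow, map_add, RatFunc.algebraMap_C] at hQ ⊢
    set F := algebraMap K[X] (RatFunc K) (φ : RatFunc K).num
    set G := algebraMap K[X] (RatFunc K) (φ : RatFunc K).denom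
    have hFG' : (φ : RatFunc K) * G = F := by rw [← hFG, div_mul_cancel₀ _ hg]
    have he : (φ : RatFunc K) * (F ^ m * G / (F ^ (m + 1) + RatFunc.C (t : K) * G ^ (m + 1))) =
        F ^ (m + 1) / (F ^ (m + 1) + RatFunc.C (t : K) * G ^ (m + 1)) := by
      rw [← mul_div_assoc]
      congr 1
      linear_combination F ^ m * hFG'
    rw [he, one_sub_div hQ, ← mul_div_assoc, ← mul_div_assoc, add_sub_cancel_left]
    congr 1
    rw [← hFG']
    ring
  intro a ha
  change intREval T ha (φ * (1 - φ * ψ)) ∈ J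
  refine hJ ⟨m + 1, ?_⟩
  have h3 := congrArg (intREval T ha) key
  rw [map_mul, map_pow, map_mul, intREval_C t.2] at h3
  -- Extra factors of 1 - φψ turn the identity `key` into a statement about a power of φ(1 - φψ), to
  -- which radicality applies.
  have h4 : intREval T ha (φ * (1 - φ * ψ)) ^ (m + 1) =
      t * intREval T ha (φ * ψ) * intREval T ha (1 - φ * ψ) ^ m := by
    rw [map_mul (intREval T ha) φ]
    linear_combination intREval T ha (1 - φ * ψ) ^ m * h3
  rw [h4]
  exact J.mul_mem_right _ (J.mul_mem_right _ htJ)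

end IsDominatingParameter

theorem isPruferDomain_intR_of_isSingularPrufer (h : IsSingularPrufer T) (hE : E.Nonempty) :
    IsPruferDomain (intR E T) := by
  by_cases hT : T = ⊤
  · rw [hT]
    exact isPruferDomain_intR_top
  · obtain ⟨t, n, ht⟩ := h.exists_isDominatingParameter hT
    exact ht.isPruferDomain_intR hE

theorem IsCommonRadicalIdeal.exists_quasiInverse {J : Ideal D} {J' : Ideal T}
    (hJ : IsCommonRadicalIdeal D T J J') (hDT : D ≤ T) (h : IsSingularPrufer T) (hE : E.Nonempty)
    (φ : intR E T) : ∃ ψ, φ * (1 - φ * ψ) ∈ intRIdeal E J' := by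
  by_cases hT : T = ⊤
  · subst hT
    have hJ' : J' = ⊤ := by
      obtain ⟨j, hj, hj0⟩ := Submodule.exists_mem_ne_zero_of_ne_bot hJ.ne_bot
      refine J'.eq_top_of_isUnit_mem (((hJ.isSharedRadicalIdeal hDT).mem_iff j).1 hj) ?_
      exact IsUnit.of_mul_eq_one ⟨(j : K)⁻¹, Subring.mem_top _⟩
        (Subtype.ext (mul_inv_cancel₀ fun h0 => hj0 (Subtype.ext h0)))
    exact ⟨0, fun a ha => hJ' ▸ Submodule.mem_top⟩
  · obtain ⟨t, n, ht⟩ := h.exists_isDominatingParameter hT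
    exact ht.exists_quasiInverse hE hJ.isRadical_right (ht.mem_of_isCommonRadicalIdeal hJ) φ

theorem IsCommonRadicalIdeal.exists_quasiInverse_range {J : Ideal D} {J' : Ideal T}
    (hJ : IsCommonRadicalIdeal D T J J') (hDT : D ≤ T) (hub : IsUnibranched hDT)
    (h : IsSingularPrufer T) (hE : E.Nonempty) (φ : intR E T) :
    ∃ ψ, φ * (1 - φ * ψ) ∈ intRIdeal E J' ∧
      φ * ψ ∈ (Subring.inclusion (intR_mono (E := E) hDT)).range := by
  obtain ⟨ψ, hψ⟩ := hJ.exists_quasiInverse hDT h hE φ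
  refine ⟨ψ, hψ, mem_range_inclusion_intR hDT fun a ha => ?_⟩
  refine (hJ.isSharedRadicalIdeal hDT).mem_range_of_mul_one_sub_mem hub ?_
  have := (intRIdeal E J').mul_mem_left ψ hψ a ha
  change intREval T ha (ψ * (φ * (1 - φ * ψ))) ∈ J' at this
  simp only [map_mul, map_sub, map_one] at this ⊢
  convert this using 1
  ring

/-- ψ need not take values in `D`, but φψ² is the normalized quasi-inverse of φ, satisfying both
relations of `mem_range_of_quasiInverse` at each point. -/
theorem IsCommonRadicalIdeal.exists_quasiInverse_left {J : Ideal D} {J' : Ideal T}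
    (hJ : IsCommonRadicalIdeal D T J J') (hDT : D ≤ T) (hub : IsUnibranched hDT)
    (h : IsSingularPrufer T) (hE : E.Nonempty) (φ : intR E D) :
    ∃ χ, φ * (1 - φ * χ) ∈ intRIdeal E J := by
  have hs := hJ.isSharedRadicalIdeal hDT
  set φ' := Subring.inclusion (intR_mono (E := E) hDT) φ
  obtain ⟨ψ, hψ⟩ := hJ.exists_quasiInverse hDT h hE φ'
  have key : ∀ (a : K) (ha : a ∈ E),
      intREval T ha φ' * (1 - intREval T ha φ' * intREval T ha ψ) ∈ J' :=
    fun a ha => by simpa only [map_mul, map_sub, map_one] using mem_intRIdeal_iff.1 hψ a ha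
  have hquasi : ∀ (a : K) (ha : a ∈ E),
      intREval T ha φ' ^ 2 * intREval T ha (φ' * ψ ^ 2) - intREval T ha φ' ∈ J' := fun a ha => by
    convert J'.mul_mem_right (-(1 + intREval T ha φ' * intREval T ha ψ)) (key a ha) using 1
    rw [map_mul, map_pow]
    ring
  have hrange : φ' * ψ ^ 2 ∈ (Subring.inclusion (intR_mono (E := E) hDT)).range := by
    refine mem_range_inclusion_intR hDT fun a ha => ?_
    refine hs.mem_range_of_quasiInverse hub (a := intREval D ha φ) ?_ (hquasi a ha)
    change intREval T ha φ' * _ - _ ∈ J'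
    convert J'.mul_mem_right (-(1 + intREval T ha φ' * intREval T ha ψ) * intREval T ha ψ ^ 2)
      (key a ha) using 1
    rw [map_mul, map_pow]
    ring
  obtain ⟨χ, hχ⟩ := hrange
  refine ⟨χ, fun a ha => (hs.mem_iff _).2 ?_⟩
  change intREval T ha (φ' * (1 - φ' * Subring.inclusion (intR_mono hDT) χ)) ∈ J'
  rw [hχ]
  convert J'.neg_mem (hquasi a ha) using 1
  simp only [map_mul, map_sub, map_one]
  ring

theorem mem_intRIdeal_inclusion_iff {J : Ideal D} {J' : Ideal T}
    (hJ : IsCommonRadicalIdeal D T J J') (hDT : D ≤ T) (φ : intR E D) :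
    φ ∈ intRIdeal E J ↔ Subring.inclusion (intR_mono hDT) φ ∈ intRIdeal E J' :=
  forall₂_congr fun _ _ => (hJ.isSharedRadicalIdeal hDT).mem_iff _

theorem exists_inclusion_eq_of_mem_intRIdeal {J : Ideal D} {J' : Ideal T}
    (hJ : IsCommonRadicalIdeal D T J J') (hDT : D ≤ T) (φ : intR E T) (hφ : φ ∈ intRIdeal E J') :
    ∃ ψ, Subring.inclusion (intR_mono hDT) ψ = φ :=
  mem_range_inclusion_intR hDT fun a ha =>
    (hJ.isSharedRadicalIdeal hDT).exists_eq _ (mem_intRIdeal_iff.1 hφ a ha)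

theorem IsCommonRadicalIdeal.intR {J : Ideal D} {J' : Ideal T}
    (hJ : IsCommonRadicalIdeal D T J J') (hDT : D ≤ T) (hub : IsUnibranched hDT)
    (h : IsSingularPrufer T) (hE : E.Nonempty) :
    IsCommonRadicalIdeal (intR E D) (intR E T) (intRIdeal E J) (intRIdeal E J') where
  same_set := by
    ext φ
    constructor
    · rintro ⟨ψ, hψ, rfl⟩
      exact ⟨_, (mem_intRIdeal_inclusion_iff hJ hDT ψ).1 hψ, rfl⟩
    · rintro ⟨ψ, hψ, rfl⟩
      obtain ⟨χ, rfl⟩ := exists_inclusion_eq_of_mem_intRIdeal hJ hDT ψ hψ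
      exact ⟨χ, (mem_intRIdeal_inclusion_iff hJ hDT χ).2 hψ, rfl⟩
  ne_bot hbot := by
    obtain ⟨j, hj, hj0⟩ := Submodule.exists_mem_ne_zero_of_ne_bot hJ.ne_bot
    have hmem : (⟨RatFunc.C (j : K), C_mem_intR j.2⟩ : _root_.intR E D) ∈ intRIdeal E J :=
      mem_intRIdeal_iff.2 fun a ha => by rwa [intREval_C]
    rw [hbot, Ideal.mem_bot] at hmem
    have h0 : RatFunc.C (j : K) = 0 := congrArg Subtype.val hmem
    rw [map_eq_zero] at h0
    exact hj0 (Subtype.ext h0)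
  isRadical_left := isRadical_intRIdeal hJ.isRadical_left
  isRadical_right := isRadical_intRIdeal hJ.isRadical_right
  isMaximal_left := isMaximal_of_quasiInverse (hJ.exists_quasiInverse_left hDT hub h hE)
  isMaximal_right := isMaximal_of_quasiInverse (hJ.exists_quasiInverse hDT h hE)

theorem IsAssociatedPruferDomain.intR (hT : IsAssociatedPruferDomain D T)
    (h : IsSingularPrufer T) (hE : E.Nonempty) :
    IsAssociatedPruferDomain (intR E D) (intR E T) := by
  obtain ⟨hDT, -, hub, J, J', hJ⟩ := hT
  have hJR := hJ.intR hDT hub h hE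
  refine ⟨intR_mono hDT, isPruferDomain_intR_of_isSingularPrufer h hE, ?_, _, _, hJR⟩
  exact bijective_comap_of_sharedIdeal (Subring.inclusion_injective _)
    (mem_intRIdeal_inclusion_iff hJ hDT) (exists_inclusion_eq_of_mem_intRIdeal hJ hDT)
    hJR.isMaximal_left (hJ.exists_quasiInverse_range hDT hub h hE)

end IntegerValued

theorem mainTheorem1 {K : Type*} [Field K] (D : Subring K) [IsFractionRing D K]
    (hD : IsPseudosingularGPVD D) (T : Subring K) (hT : IsAssociatedPruferDomain D T)
    (E : Set K) (hE : E.Nonempty) :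
    IsGPVD (intR E D) ∧
    (∀ S : Subring (RatFunc K), IsAssociatedPruferDomain (intR E D) S ↔ S = intR E T) ∧
    ∀ (J : Ideal D) (J' : Ideal T), IsCommonRadicalIdeal D T J J' →
      IsCommonRadicalIdeal (intR E D) (intR E T) (intRIdeal E J) (intRIdeal E J') := by
  have hsing : IsSingularPrufer T := by
    obtain ⟨T₀, hT₀, hsing⟩ := hD
    rwa [hT.unique hT₀]
  have hR := hT.intR hsing hE
  refine ⟨⟨_, hR⟩, fun S => ⟨fun hS => hS.unique hR, fun hS => hS ▸ hR⟩, fun J J' hJ => ?_⟩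
  obtain ⟨hDT, -, hub, -⟩ := hT
  exact hJ.intR hDT hub hsing hE
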